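/- Let $S$ be a measurable space, let $P$ be a Markov transition kernel on $S$, let $m\ge 1$, and let $P^m_x:=\mathsf P_x(m,\cdot)$ be the $m$-step transition probability from $x$. For probability measures $\mu,\nu$ on $S$ with densities $p,q$ with respect to $\Lambda=\mu+\nu$, write $\mu\wedge\nu$ for the measure with density $p\wedge q$ with respect to $\Lambda$, and let $a(\mu,\nu):=\int (p\wedge q)\,d\Lambda=(\mu\wedge\nu)(S)$. Put $\delta^{(m)}(x,x'):=a(P^m_x,P^m_{x'})\in[0,1]$. Assume that $(x,x')\mapsto P^m_x\wedge P^m_{x'}$ is measurable, i.e. $(x,x')\mapsto (P^m_x\wedge P^m_{x'})(A)$ is measurable for every measurable $A$ (this is automatic if the $\sigma$-algebra of $S$ is countably generated). **Coupling.** Let $\mu_1,\mu_2$ be probability measures on $S$. Let $(\eta^1_{nm},\eta^2_{nm},\xi_{nm},\zeta_{nm})_{n\ge0}$ be a homogeneous Markov process with values in $S\times S\times S\times\{0,1\}$ with the following initial law and transition kernel. *Initial law.* Let $a_0=a(\mu_1,\mu_2)$. If $0<a_0<1$, then $\eta^1_0,\eta^2_0,\xi_0,\zeta_0$ are independent with laws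 $\frac{\mu_1-\mu_1\wedge\mu_2}{1-a_0}$, $\frac{\mu_2-\mu_1\wedge\mu_2}{1-a_0}$, $\frac{\mu_1\wedge\mu_2}{a_0}$, and $\mathsf P(\zeta_0=0)=a_0=1-\mathsf P(\zeta_0=1)$. If $a_0=0$, the initial law is that of $(Z^1,Z^2,Z^1,1)$ with independent $Z^1\sim\mu_1$, $Z^2\sim\mu_2$. If $a_0=1$, it is that of $(Z,Z,Z,0)$ with $Z\sim\mu_1$. *Transition.* From the state $(x^1,x^2,x^3,x^4)$, writing $\delta=\delta^{(m)}(x^1,x^2)$ and $\kappa=P^m_{x^1}\wedge P^m_{x^2}$, the four new components are independent, and * the new $\eta^1$ and $\eta^2$ have laws $\frac{P^m_{x^1}-\kappa}{1-\delta}$ and $\frac{P^m_{x^2}-\kappa}{1-\delta}$ if $\delta<1$, and both have law $P^m_{x^1}$ if $\delta=1$; * the new $\xi$ has law $\kappa/\delta$ if $x^4=1$ and $\delta>0$, and law $P^m_{x^3}$ otherwise; * the new $\zeta$ equals $0$ with probability $\delta$ and $1$ with probability $1-\delta$ if $x^4=1$, and equals $0$ if $x^4=0$. Such a process exists. For every such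 process put, for $n\ge0$ and $i=1,2$, $$\widetilde X^i_{nm}:=\eta^i_{nm}1(\zeta_{nm}=1)+\xi_{nm}1(\zeta_{nm}=0)$$ (that is, $\widetilde X^i_{nm}$ is $\eta^i_{nm}$ if $\zeta_{nm}=1$ and $\xi_{nm}$ if $\zeta_{nm}=0$). Let $(X^i_n)_{n\ge0}$ be a homogeneous Markov process with transition kernel $P$ and initial law $\mu_i$, and let $\mu^{(i)}_{k}$ be the law of $X^i_{k}$, $i=1,2$. Then the following hold. 1. For $i=1,2$: $\widetilde X^i_{nm}\stackrel{d}{=}X^i_{nm}$ for all $n\ge0$; moreover $(\widetilde X^i_{nm})_{n\ge0}\stackrel{d}{=}(X^i_{nm})_{n\ge0}$ in the space of trajectories, and $(\widetilde X^i_{nm})_{n\ge0}$ is a homogeneous Markov process with transition kernel $P^m$ and initial law $\mu_i$. 2. The pair $(\widetilde X^1_{nm},\widetilde X^2_{nm})_{n\ge0}$ is a homogeneous Markov process, with a transition kernel on $S\times S$ that does not depend on $\mu_1,\mu_2$. 3. Almost surely, $\widetilde X^1_{nm}=\widetilde X^2_{nm}$ for all $n\ge n_0(\omega):=\inf\{k\ge0:\zeta_{km}=0\}$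 ($\inf\emptyset=\infty$). 4. For every $n\ge0$, $$\tfrac12\,\bigl\|\mu^{(1)}_{nm}-\mu^{(2)}_{nm}\bigr\|_{TV}\le \mathsf P\bigl(\widetilde X^1_{nm}\ne\widetilde X^2_{nm}\bigr)\le \mathsf E\prod_{i=0}^{n-1}\bigl(1-\delta^{(m)}(\eta^1_{im},\eta^2_{im})\bigr),$$ where $\|\cdot\|_{TV}$ is the total variation norm of signed measures (the total mass of the total variation) and the probability is the outer probability should the event fail to be measurable. In particular this holds for $\mu_1=\delta_{x^1}$ (the point mass at $x^1$) and $\mu_2=\mu_0$. -/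

import Mathlib

open MeasureTheory ProbabilityTheory Set
open scoped ENNReal

universe u v₁ v₂ v

namespace MarkovCoupling

noncomputable section

/-! ### Common part and excess of two measures -/

section Measures

variable {S : Type*} [MeasurableSpace S]

/-- The common part `p ∧ q` of two measures, where `p` and `q` are their densities with respect to
the sum `Λ = μ + ν`; it is the measure with density `p ∧ q` with respect to `Λ`. -/
def commonPart (μ ν : Measure S) : Measure S :=
  (μ + ν).withDensity (fun u => min (μ.rnDeriv (μ + ν) u) (ν.rnDeriv (μ + ν) u))

/-- The overlap `∫ (p ∧ q) dΛ`, with densities taken with respect to `Λ = μ + ν`. -/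
def overlap (μ ν : Measure S) : ℝ≥0∞ :=
  ∫⁻ u, min (μ.rnDeriv (μ + ν) u) (ν.rnDeriv (μ + ν) u) ∂(μ + ν)

/-- The excess of `μ` over `ν`: the measure with density `p - p ∧ q` with respect to
`Λ = μ + ν`, with `p`, `q` the densities of `μ`, `ν`. -/
def excess (μ ν : Measure S) : Measure S :=
  (μ + ν).withDensity
    (fun u => μ.rnDeriv (μ + ν) u - min (μ.rnDeriv (μ + ν) u) (ν.rnDeriv (μ + ν) u))

/-- The law on `{0, 1}` with mass `a` at `0` and mass `1 - a` at `1`. -/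
def switchLaw (a : ℝ≥0∞) : Measure (Fin 2) :=
  a • Measure.dirac 0 + (1 - a) • Measure.dirac 1

/-- The total variation norm `‖μ - ν‖_TV`, that is, the total mass of the total variation
measure of the signed measure `μ - ν`. -/
def tvNorm (μ ν : Measure S) [IsFiniteMeasure μ] [IsFiniteMeasure ν] : ℝ≥0∞ :=
  (μ.toSignedMeasure - ν.toSignedMeasure).totalVariation univ

theorem commonPart_univ (μ ν : Measure S) : commonPart μ ν univ = overlap μ ν := by
  simp [commonPart, overlap]

theorem commonPart_add_excess (μ ν : Measure S) [IsFiniteMeasure μ] [IsFiniteMeasure ν] :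
    commonPart μ ν + excess μ ν = μ := by
  have hμ : μ ≪ μ + ν := Measure.AbsolutelyContinuous.rfl.add_right ν
  rw [commonPart, excess, ← withDensity_add_left]
  · conv_rhs => rw [← Measure.withDensity_rnDeriv_eq μ (μ + ν) hμ]
    congr 1
    ext u
    exact add_tsub_cancel_of_le (min_le_left _ _)
  · exact (Measure.measurable_rnDeriv _ _).min (Measure.measurable_rnDeriv _ _)

theorem commonPart_comm (μ ν : Measure S) : commonPart μ ν = commonPart ν μ := by
  simp only [commonPart, add_comm ν μ, min_comm]

theorem overlap_comm (μ ν : Measure S) : overlap μ ν = overlap ν μ := by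
  rw [← commonPart_univ, commonPart_comm, commonPart_univ]

theorem commonPart_le (μ ν : Measure S) [IsFiniteMeasure μ] [IsFiniteMeasure ν] :
    commonPart μ ν ≤ μ := by
  conv_rhs => rw [← commonPart_add_excess μ ν]
  exact Measure.le_add_right le_rfl

theorem overlap_le_one (μ ν : Measure S) [IsProbabilityMeasure μ] [IsFiniteMeasure ν] :
    overlap μ ν ≤ 1 := by
  rw [← commonPart_univ, ← measure_univ (μ := μ)]
  exact commonPart_le μ ν univ

theorem excess_apply (μ ν : Measure S) [IsFiniteMeasure μ] [IsFiniteMeasure ν] (A : Set S) :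
    excess μ ν A = μ A - commonPart μ ν A := by
  have h : μ A = commonPart μ ν A + excess μ ν A := by
    conv_lhs => rw [← commonPart_add_excess μ ν]
    rfl
  have hfin : commonPart μ ν A ≠ ∞ :=
    ne_top_of_le_ne_top (measure_ne_top μ A) (commonPart_le μ ν A)
  rw [h, ENNReal.add_sub_cancel_left hfin]

/-- The initial law of `(η¹, η², ξ, ζ)`: the four components are independent, with laws
`excess μ₁ μ₂ / (1 - a)`, `excess μ₂ μ₁ / (1 - a)`, `commonPart μ₁ μ₂ / a` and `switchLaw a`,
where `a = overlap μ₁ μ₂`. In the degenerate cases: if `a = 0` it is the law of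
`(X¹, X², X¹, 1)` with independent `X¹ ∼ μ₁`, `X² ∼ μ₂`; if `a = 1` it is the law of
`(X¹, X¹, X¹, 0)`. -/
def couplingInit (μ₁ μ₂ : Measure S) : Measure (S × S × S × Fin 2) :=
  open Classical in
  if overlap μ₁ μ₂ = 0 then
    (μ₁.prod μ₂).map (fun x => (x.1, x.2, x.1, (1 : Fin 2)))
  else if overlap μ₁ μ₂ = 1 then
    μ₁.map (fun x => (x, x, x, (0 : Fin 2)))
  else
    ((1 - overlap μ₁ μ₂)⁻¹ • excess μ₁ μ₂).prod
      (((1 - overlap μ₁ μ₂)⁻¹ • excess μ₂ μ₁).prod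
        (((overlap μ₁ μ₂)⁻¹ • commonPart μ₁ μ₂).prod (switchLaw (overlap μ₁ μ₂))))

end Measures

/-! ### Homogeneous Markov processes in discrete time -/

/-- `X` is a homogeneous Markov process on `(Ω, Pr)` with transition kernel `κ` and initial law
`μ`: for every `n`, the conditional probability of `X (n + 1) ∈ A` given the past
`σ(X 0, …, X n)` is `κ (X n) A`. -/
structure IsMarkovProcess {E Ω : Type*} [MeasurableSpace E] [MeasurableSpace Ω]
    (κ : Kernel E E) (μ : Measure E) (X : ℕ → Ω → E) (Pr : Measure Ω) : Prop where
  measurable : ∀ n, Measurable (X n)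
  init : Pr.map (X 0) = μ
  markov : ∀ (n : ℕ) (A : Set E), MeasurableSet A → ∀ B : Set Ω,
    MeasurableSet[⨆ j ∈ Set.Iic n, MeasurableSpace.comap (X j) inferInstance] B →
    Pr (B ∩ X (n + 1) ⁻¹' A) = ∫⁻ ω in B, κ (X n ω) A ∂Pr

/-! ### The transition kernel of the coupling -/

section Transition

variable {S : Type*} [MeasurableSpace S]

/-- The common part of the transition probabilities from `x` and from `x'` depends measurably on
`(x, x')`. -/
def MeasurableCommonPart (κ : Kernel S S) : Prop :=
  Measurable (fun z : S × S => commonPart (κ z.1) (κ z.2))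

/-- On a countably generated measurable space the common part is always measurable. -/
theorem measurableCommonPart_of_countablyGenerated [MeasurableSpace.CountablyGenerated S]
    (κ : Kernel S S) [IsFiniteKernel κ] : MeasurableCommonPart κ := by
  let κ₁ : Kernel (S × S) S := κ.comap Prod.fst measurable_fst
  let κ₂ : Kernel (S × S) S := κ.comap Prod.snd measurable_snd
  let f : S × S → S → ℝ≥0∞ := fun z u =>
    min (Kernel.rnDeriv κ₁ (κ₁ + κ₂) z u) (Kernel.rnDeriv κ₂ (κ₁ + κ₂) z u)
  have hf : Measurable (Function.uncurry f) :=
    (Kernel.measurable_rnDeriv κ₁ (κ₁ + κ₂)).min (Kernel.measurable_rnDeriv κ₂ (κ₁ + κ₂))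
  have h : (fun z : S × S => commonPart (κ z.1) (κ z.2)) =
      fun z => Kernel.withDensity (κ₁ + κ₂) f z := by
    ext1 z
    rw [Kernel.withDensity_apply _ hf]
    refine withDensity_congr_ae ?_
    have h₁ := Kernel.rnDeriv_eq_rnDeriv_measure (κ := κ₁) (η := κ₁ + κ₂) (a := z)
    have h₂ := Kernel.rnDeriv_eq_rnDeriv_measure (κ := κ₂) (η := κ₁ + κ₂) (a := z)
    filter_upwards [h₁, h₂] with u hu₁ hu₂
    simp only [f, hu₁, hu₂]
    rfl
  unfold MeasurableCommonPart
  rw [h]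
  exact Kernel.measurable _

variable (κ : Kernel S S)

/-- The law `φ₁(x, ·)` of the next value of `η¹`. -/
def phi₁ (x : S × S × S × Fin 2) : Measure S :=
  open Classical in
  if overlap (κ x.1) (κ x.2.1) = 1 then κ x.1
  else (1 - overlap (κ x.1) (κ x.2.1))⁻¹ • excess (κ x.1) (κ x.2.1)

/-- The law `φ₂(x, ·)` of the next value of `η²`. -/
def phi₂ (x : S × S × S × Fin 2) : Measure S :=
  open Classical in
  if overlap (κ x.1) (κ x.2.1) = 1 then κ x.1
  else (1 - overlap (κ x.1) (κ x.2.1))⁻¹ • excess (κ x.2.1) (κ x.1)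

/-- The law `φ₃(x, ·)` of the next value of `ξ`. -/
def phi₃ (x : S × S × S × Fin 2) : Measure S :=
  open Classical in
  if x.2.2.2 = 1 ∧ overlap (κ x.1) (κ x.2.1) ≠ 0 then
    (overlap (κ x.1) (κ x.2.1))⁻¹ • commonPart (κ x.1) (κ x.2.1)
  else κ x.2.2.1

/-- The law `φ₄(x, ·)` of the next value of `ζ`. -/
def phi₄ (x : S × S × S × Fin 2) : Measure (Fin 2) :=
  if x.2.2.2 = 1 then switchLaw (overlap (κ x.1) (κ x.2.1)) else Measure.dirac 0

variable {κ}

theorem measurable_overlap (hκ : MeasurableCommonPart κ) :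
    Measurable (fun z : S × S => overlap (κ z.1) (κ z.2)) := by
  simp only [← commonPart_univ]
  exact (Measure.measurable_coe MeasurableSet.univ).comp hκ

theorem measurable_overlap' (hκ : MeasurableCommonPart κ) :
    Measurable (fun x : S × S × S × Fin 2 => overlap (κ x.1) (κ x.2.1)) :=
  (measurable_overlap hκ).comp (measurable_fst.prodMk (measurable_fst.comp measurable_snd))

theorem measurable_commonPart' (hκ : MeasurableCommonPart κ) :
    Measurable (fun x : S × S × S × Fin 2 => commonPart (κ x.1) (κ x.2.1)) := by
  unfold MeasurableCommonPart at hκ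
  generalize (commonPart : Measure S → Measure S → Measure S) = c at hκ ⊢
  have h' : Measurable (fun x : S × S × S × Fin 2 => (x.1, x.2.1)) :=
    measurable_fst.prodMk (measurable_fst.comp measurable_snd)
  exact hκ.comp h'

theorem measurable_smul_measure {α β : Type*} [MeasurableSpace α] [MeasurableSpace β]
    {c : α → ℝ≥0∞} {μ : α → Measure β} (hc : Measurable c) (hμ : Measurable μ) :
    Measurable (fun a => c a • μ a) := by
  refine Measure.measurable_of_measurable_coe _ fun A hA => ?_
  simp only [Measure.smul_apply, smul_eq_mul]
  exact hc.mul ((Measure.measurable_coe hA).comp hμ)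

theorem measurable_phi₃ (hκ : MeasurableCommonPart κ) : Measurable (phi₃ κ) := by
  classical
  refine Measurable.ite ?_ (measurable_smul_measure (measurable_overlap' hκ).inv
    (measurable_commonPart' hκ))
    (κ.measurable.comp (measurable_fst.comp (measurable_snd.comp measurable_snd)))
  refine MeasurableSet.inter (?_ : MeasurableSet {x : S × S × S × Fin 2 | x.2.2.2 = 1})
    (measurable_overlap' hκ (measurableSet_singleton 0).compl)
  exact (measurable_snd.comp (measurable_snd.comp measurable_snd)) (measurableSet_singleton 1)

theorem measurable_phi₄ (hκ : MeasurableCommonPart κ) : Measurable (phi₄ κ) := by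
  refine Measurable.ite ?_ ?_ measurable_const
  · exact (measurable_snd.comp (measurable_snd.comp measurable_snd)) (measurableSet_singleton 1)
  · refine Measure.measurable_of_measurable_coe _ fun A hA => ?_
    simp only [switchLaw, Measure.add_apply, Measure.smul_apply, smul_eq_mul]
    exact ((measurable_overlap' hκ).mul_const _).add
      ((measurable_const.sub (measurable_overlap' hκ)).mul_const _)

variable [IsMarkovKernel κ]

theorem measurable_phi₁ (hκ : MeasurableCommonPart κ) : Measurable (phi₁ κ) := by
  classical
  have h1 : Measurable (fun x : S × S × S × Fin 2 => κ x.1) := κ.measurable.comp measurable_fst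
  refine Measurable.ite (measurable_overlap' hκ (measurableSet_singleton 1)) h1
    (measurable_smul_measure (measurable_const.sub (measurable_overlap' hκ)).inv ?_)
  refine Measure.measurable_of_measurable_coe _ fun A hA => ?_
  simp only [excess_apply]
  exact ((Measure.measurable_coe hA).comp h1).sub
    ((Measure.measurable_coe hA).comp (measurable_commonPart' hκ))

theorem measurable_phi₂ (hκ : MeasurableCommonPart κ) : Measurable (phi₂ κ) := by
  classical
  have h1 : Measurable (fun x : S × S × S × Fin 2 => κ x.1) := κ.measurable.comp measurable_fst
  have h2 : Measurable (fun x : S × S × S × Fin 2 => κ x.2.1) :=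
    κ.measurable.comp (measurable_fst.comp measurable_snd)
  refine Measurable.ite (measurable_overlap' hκ (measurableSet_singleton 1)) h1
    (measurable_smul_measure (measurable_const.sub (measurable_overlap' hκ)).inv ?_)
  refine Measure.measurable_of_measurable_coe _ fun A hA => ?_
  simp only [excess_apply, commonPart_comm (κ (_ : S × S × S × Fin 2).2.1)]
  exact ((Measure.measurable_coe hA).comp h2).sub
    ((Measure.measurable_coe hA).comp (measurable_commonPart' hκ))

theorem isProbabilityMeasure_excess {μ ν : Measure S} [IsProbabilityMeasure μ]
    [IsFiniteMeasure ν] (h : overlap μ ν ≠ 1) :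
    IsProbabilityMeasure ((1 - overlap μ ν)⁻¹ • excess μ ν) := by
  constructor
  rw [Measure.smul_apply, excess_apply, commonPart_univ, measure_univ, smul_eq_mul]
  refine ENNReal.inv_mul_cancel ?_ (ENNReal.sub_ne_top ENNReal.one_ne_top)
  exact (tsub_pos_of_lt (lt_of_le_of_ne (overlap_le_one μ ν) h)).ne'

theorem isProbabilityMeasure_commonPart {μ ν : Measure S} [IsProbabilityMeasure μ]
    [IsFiniteMeasure ν] (h : overlap μ ν ≠ 0) :
    IsProbabilityMeasure ((overlap μ ν)⁻¹ • commonPart μ ν) := by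
  constructor
  rw [Measure.smul_apply, commonPart_univ, smul_eq_mul]
  exact ENNReal.inv_mul_cancel h (ne_top_of_le_ne_top ENNReal.one_ne_top (overlap_le_one μ ν))

theorem isProbabilityMeasure_switchLaw {a : ℝ≥0∞} (h : a ≤ 1) :
    IsProbabilityMeasure (switchLaw a) := by
  constructor
  simp [switchLaw, add_tsub_cancel_of_le h]

instance (x : S × S × S × Fin 2) : IsProbabilityMeasure (phi₁ κ x) := by
  unfold phi₁
  split_ifs with h
  · infer_instance
  · exact isProbabilityMeasure_excess h

instance (x : S × S × S × Fin 2) : IsProbabilityMeasure (phi₂ κ x) := by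
  unfold phi₂
  split_ifs with h
  · infer_instance
  · rw [overlap_comm] at h ⊢
    exact isProbabilityMeasure_excess h

instance (x : S × S × S × Fin 2) : IsProbabilityMeasure (phi₃ κ x) := by
  unfold phi₃
  split_ifs with h
  · exact isProbabilityMeasure_commonPart h.2
  · infer_instance

instance (x : S × S × S × Fin 2) : IsProbabilityMeasure (phi₄ κ x) := by
  unfold phi₄
  split_ifs with h
  · exact isProbabilityMeasure_switchLaw (overlap_le_one _ _)
  · infer_instance

/-- The transition kernel `φ(x, ·) = φ₁(x, ·) ⊗ φ₂(x, ·) ⊗ φ₃(x, ·) ⊗ φ₄(x, ·)` of the process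
`(η¹, η², ξ, ζ)`. -/
def couplingKernel (κ : Kernel S S) [IsMarkovKernel κ] (hκ : MeasurableCommonPart κ) :
    Kernel (S × S × S × Fin 2) (S × S × S × Fin 2) where
  toFun x := (phi₁ κ x).prod ((phi₂ κ x).prod ((phi₃ κ x).prod (phi₄ κ x)))
  measurable' := by
    let k₁ : Kernel (S × S × S × Fin 2) S := ⟨phi₁ κ, measurable_phi₁ hκ⟩
    let k₂ : Kernel (S × S × S × Fin 2) S := ⟨phi₂ κ, measurable_phi₂ hκ⟩
    let k₃ : Kernel (S × S × S × Fin 2) S := ⟨phi₃ κ, measurable_phi₃ hκ⟩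
    let k₄ : Kernel (S × S × S × Fin 2) (Fin 2) := ⟨phi₄ κ, measurable_phi₄ hκ⟩
    have : IsMarkovKernel k₁ := ⟨fun x => inferInstanceAs (IsProbabilityMeasure (phi₁ κ x))⟩
    have : IsMarkovKernel k₂ := ⟨fun x => inferInstanceAs (IsProbabilityMeasure (phi₂ κ x))⟩
    have : IsMarkovKernel k₃ := ⟨fun x => inferInstanceAs (IsProbabilityMeasure (phi₃ κ x))⟩
    have : IsMarkovKernel k₄ := ⟨fun x => inferInstanceAs (IsProbabilityMeasure (phi₄ κ x))⟩
    have h : (fun x => (phi₁ κ x).prod ((phi₂ κ x).prod ((phi₃ κ x).prod (phi₄ κ x)))) =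
        fun x => (k₁ ×ₖ (k₂ ×ₖ (k₃ ×ₖ k₄))) x := by
      ext1 x
      simp only [Kernel.prod_apply]
      rfl
    rw [h]
    exact Kernel.measurable _

instance (hκ : MeasurableCommonPart κ) : IsMarkovKernel (couplingKernel κ hκ) :=
  ⟨fun x => inferInstanceAs (IsProbabilityMeasure
    ((phi₁ κ x).prod ((phi₂ κ x).prod ((phi₃ κ x).prod (phi₄ κ x)))))⟩

end Transition

/-- The `m`-step transition kernel of a Markov kernel is Markov. -/
instance isMarkovKernel_pow {S : Type*} [MeasurableSpace S] (P : Kernel S S) [IsMarkovKernel P]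
    (m : ℕ) : IsMarkovKernel (P ^ m) := by
  induction m with
  | zero => rw [pow_zero]; exact inferInstanceAs (IsMarkovKernel Kernel.id)
  | succ k ih => rw [pow_succ]; exact inferInstanceAs (IsMarkovKernel ((P ^ k) ∘ₖ P))

/-! ### The coupled processes -/

section Coupled

variable {S Ω : Type*}

/-- `X̃¹ = η¹ 1(ζ = 1) + ξ 1(ζ = 0)`, for `Y = (η¹, η², ξ, ζ)`. -/
def coupled₁ (Y : ℕ → Ω → S × S × S × Fin 2) (n : ℕ) (ω : Ω) : S :=
  if (Y n ω).2.2.2 = 1 then (Y n ω).1 else (Y n ω).2.2.1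

/-- `X̃² = η² 1(ζ = 1) + ξ 1(ζ = 0)`, for `Y = (η¹, η², ξ, ζ)`. -/
def coupled₂ (Y : ℕ → Ω → S × S × S × Fin 2) (n : ℕ) (ω : Ω) : S :=
  if (Y n ω).2.2.2 = 1 then (Y n ω).2.1 else (Y n ω).2.2.1

/-- The coupling time `inf {k ≥ 0 : ζ_k = 0}`, equal to `⊤` if `ζ` never vanishes. -/
def couplingTime (Y : ℕ → Ω → S × S × S × Fin 2) (ω : Ω) : ℕ∞ :=
  ⨅ k : {k : ℕ // (Y k ω).2.2.2 = 0}, ((k : ℕ) : ℕ∞)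

end Coupled

end

end MarkovCoupling

/-! The coupled pair is a function of the state: (η¹, η²) while ζ = 1 and (ξ, ξ) once ζ = 0. The
main point is that this function lumps the coupling kernel. While ζ = 1 the next pair has law (1 -
δ) φ₁ ⊗ φ₂ plus the common part placed on the diagonal. When ζ = 0 it has the law of one `P ^
m`-step placed on the diagonal, and this is the same formula at the point (ξ, ξ), where the overlap
is 1 and the common part is the whole law. Hence the pair is Markov
(`couplingKernel_map_eq_pairKernel`, `IsMarkovProcess.lump`). Excess plus common part gives back
each original law, so the coordinate projections lump the pair kernel to `P ^ m`. Equality of laws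
follows from uniqueness of the path law (`map_path_eq`), applied against the chain observed at
multiples of m.

The value ζ = 0 is absorbing, so the two components agree from then on. For the estimate, unequal
values force ζ = 1. One step from ζ = 1 keeps ζ = 1 with probability 1 - δ, independently of the new
(η¹, η²), and the law of the new (η¹, η²) ignores ξ and ζ. Induction with an arbitrary test function
of (η¹, η²) yields the product (`lintegral_switch_le`); the total variation bound is the coupling
inequality. -/

namespace MarkovCoupling

/-! ### Markov processes: lumping, skeletons, uniqueness and existence -/

section MarkovProcess

variable {E Ω : Type*} [MeasurableSpace E]

/-- The `σ`-algebra generated by `X 0, …, X n`. -/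
abbrev past (X : ℕ → Ω → E) (n : ℕ) : MeasurableSpace Ω :=
  ⨆ j ∈ Set.Iic n, MeasurableSpace.comap (X j) inferInstance

theorem comap_le_past (X : ℕ → Ω → E) {j n : ℕ} (h : j ≤ n) :
    MeasurableSpace.comap (X j) inferInstance ≤ past X n :=
  le_iSup₂_of_le (f := fun j (_ : j ∈ Set.Iic n) =>
    MeasurableSpace.comap (X j) inferInstance) j h le_rfl

theorem past_mono (X : ℕ → Ω → E) {n k : ℕ} (h : n ≤ k) : past X n ≤ past X k :=
  iSup₂_le fun _ hj => comap_le_past X (le_trans hj h)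

/-- The trajectory stopped at time `n`. -/
def stoppedPath (X : ℕ → Ω → E) (n : ℕ) (ω : Ω) : ℕ → E := fun k => X (min k n) ω

theorem stoppedPath_succ {E Ω : Type*} (X : ℕ → Ω → E) (n : ℕ) :
    stoppedPath X (n + 1) = (fun (p : (ℕ → E) × E) k => if k ≤ n then p.1 k else p.2) ∘
      fun ω => (stoppedPath X n ω, X (n + 1) ω) := by
  ext ω k
  by_cases hk : k ≤ n
  · simp [stoppedPath, hk, hk.trans n.le_succ]
  · have : min k (n + 1) = n + 1 := by omega
    simp [stoppedPath, hk, this]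

theorem measurable_stoppedPath_past (X : ℕ → Ω → E) (n : ℕ) :
    Measurable[past X n] (stoppedPath X n) :=
  @measurable_pi_lambda _ _ _ (past X n) _ _ fun k =>
    (measurable_iff_comap_le (m₁ := past X n)).2 (comap_le_past X (min_le_right k n))

variable {F : Type*} [MeasurableSpace F]

theorem past_comp_le {g : E → F} (hg : Measurable g) (X : ℕ → Ω → E) (n : ℕ) :
    past (fun k ω => g (X k ω)) n ≤ past X n := by
  refine iSup₂_le fun j hj => le_trans ?_ (comap_le_past X hj)
  change MeasurableSpace.comap (g ∘ X j) inferInstance ≤ _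
  rw [← MeasurableSpace.comap_comp]
  exact MeasurableSpace.comap_mono hg.comap_le

variable [MeasurableSpace Ω] {κ : Kernel E E} {μ : Measure E} {X : ℕ → Ω → E} {Pr : Measure Ω}

theorem measurable_stoppedPath (hX : ∀ n, Measurable (X n)) (n : ℕ) :
    Measurable (stoppedPath X n) :=
  measurable_pi_lambda _ fun _ => hX _

namespace IsMarkovProcess

/-- The Markov property as a disintegration: given the past, the next value is drawn from κ at the
present. Stopped paths encode every past in the same space `ℕ → E`. Rectangles suffice because the
measures are finite. -/
theorem map_stoppedPath_prodMk [IsFiniteMeasure Pr] [IsMarkovKernel κ]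
    (h : IsMarkovProcess κ μ X Pr) (n : ℕ) :
    Pr.map (fun ω => (stoppedPath X n ω, X (n + 1) ω)) =
      (Pr.map (stoppedPath X n)) ⊗ₘ (κ.comap (fun f : ℕ → E => f n) (measurable_pi_apply n)) := by
  have hT := measurable_stoppedPath h.measurable n
  refine Measure.ext_prod fun {B A} hB hA => ?_
  rw [Measure.map_apply (hT.prodMk (h.measurable _)) (hB.prod hA),
    Measure.compProd_apply_prod hB hA, setLIntegral_map hB (Kernel.measurable_coe _ hA) hT]
  have := h.markov n A hA _ (measurable_stoppedPath_past X n hB)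
  simpa [stoppedPath, Kernel.comap_apply, mk_preimage_prod] using this

theorem lintegral_stoppedPath [IsFiniteMeasure Pr] [IsMarkovKernel κ]
    (h : IsMarkovProcess κ μ X Pr) (n : ℕ) {f : (ℕ → E) × E → ℝ≥0∞} (hf : Measurable f) :
    ∫⁻ ω, f (stoppedPath X n ω, X (n + 1) ω) ∂Pr =
      ∫⁻ ω, ∫⁻ y, f (stoppedPath X n ω, y) ∂κ (X n ω) ∂Pr := by
  have hT := measurable_stoppedPath h.measurable n
  rw [← lintegral_map (f := f) hf (hT.prodMk (h.measurable _)), h.map_stoppedPath_prodMk,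
    Measure.lintegral_compProd hf, lintegral_map ?_ hT]
  · simp [Kernel.comap_apply, stoppedPath]
  · exact hf.lintegral_kernel_prod_right'

/-- A measurable function that lumps the transition kernel maps a Markov process to a Markov
process. -/
theorem lump (h : IsMarkovProcess κ μ X Pr) {Q : Kernel F F} {g : E → F} (hg : Measurable g)
    (hQ : ∀ x, (κ x).map g = Q (g x)) :
    IsMarkovProcess Q (μ.map g) (fun n ω => g (X n ω)) Pr where
  measurable n := hg.comp (h.measurable n)
  init := by rw [← h.init, Measure.map_map hg (h.measurable 0)]; rfl
  markov n A hA B hB := by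
    -- The image process has the smaller past, and the conditional probability κ(x, g⁻¹ A) is
    -- already a function of g x.
    have := h.markov n _ (hg hA) B (past_comp_le hg X n B hB)
    rw [show (fun ω => g (X (n + 1) ω)) ⁻¹' A = X (n + 1) ⁻¹' (g ⁻¹' A) from rfl, this]
    simp_rw [← hQ, Measure.map_apply hg hA]

/-- Chapman–Kolmogorov under the restriction to B: an event of the past of n stays in the past of
every later time, so the one-step relation can be iterated without changing B. -/
theorem restrict_map_add [IsFiniteMeasure Pr] (h : IsMarkovProcess κ μ X Pr)
    {n : ℕ} {B : Set Ω} (hB : MeasurableSet[past X n] B) (k : ℕ) :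
    (Pr.restrict B).map (X (n + k)) = (κ ^ k) ∘ₘ ((Pr.restrict B).map (X n)) := by
  induction k with
  | zero => rw [pow_zero]; exact Measure.id_comp.symm
  | succ k ih =>
    have : κ ^ (k + 1) = κ ∘ₖ (κ ^ k) := pow_succ' κ k
    rw [this, ← Measure.comp_assoc, ← ih]
    ext A hA
    rw [Measure.map_apply (h.measurable _) hA, Measure.bind_apply hA κ.measurable.aemeasurable,
      Measure.restrict_apply (h.measurable _ hA), inter_comm,
      lintegral_map (Kernel.measurable_coe _ hA) (h.measurable _)]
    exact h.markov (n + k) A hA B (past_mono X (Nat.le_add_right n k) B hB)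

/-- The chain observed at the multiples of `m`. -/
theorem skeleton [IsFiniteMeasure Pr] (h : IsMarkovProcess κ μ X Pr) (m : ℕ) :
    IsMarkovProcess (κ ^ m) μ (fun n => X (n * m)) Pr where
  measurable n := h.measurable _
  init := by rw [← h.init, zero_mul]
  markov n A hA B hB := by
    have hB' : MeasurableSet[past X (n * m)] B := by
      refine (iSup₂_le fun j hj => ?_ : past (fun n => X (n * m)) n ≤ past X (n * m)) B hB
      exact comap_le_past X (Nat.mul_le_mul_right m hj)
    have := DFunLike.congr_fun (h.restrict_map_add hB' m) A
    rw [Measure.map_apply (h.measurable _) hA,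
      Measure.bind_apply hA (κ ^ m).measurable.aemeasurable,
      Measure.restrict_apply (h.measurable _ hA), inter_comm,
      lintegral_map (Kernel.measurable_coe _ hA) (h.measurable _)] at this
    rw [← this, Nat.succ_mul]

/-- The law of the trajectory of a Markov process is determined by the kernel and the initial
law. -/
theorem map_path_eq {Ω' : Type*} [MeasurableSpace Ω'] {X' : ℕ → Ω' → E} {Pr' : Measure Ω'}
    [IsProbabilityMeasure Pr] [IsProbabilityMeasure Pr'] [IsMarkovKernel κ]
    (h : IsMarkovProcess κ μ X Pr) (h' : IsMarkovProcess κ μ X' Pr') :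
    Pr.map (fun ω n => X n ω) = Pr'.map (fun ω n => X' n ω) := by
  have hm := measurable_pi_lambda _ h.measurable
  have hm' := measurable_pi_lambda _ h'.measurable
  -- The law up to time n + 1 is the law up to time n extended by the same kernel.
  have key : ∀ n, Pr.map (stoppedPath X n) = Pr'.map (stoppedPath X' n) := by
    intro n
    induction n with
    | zero =>
      have hc : Measurable (fun (x : E) (_ : ℕ) => x) := measurable_pi_lambda _ fun _ => measurable_id
      have e : stoppedPath X 0 = (fun (x : E) (_ : ℕ) => x) ∘ X 0 := by
        ext ω k; simp [stoppedPath]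
      have e' : stoppedPath X' 0 = (fun (x : E) (_ : ℕ) => x) ∘ X' 0 := by
        ext ω k; simp [stoppedPath]
      rw [e, e', ← Measure.map_map hc (h.measurable 0), ← Measure.map_map hc (h'.measurable 0),
        h.init, h'.init]
    | succ n ih =>
      have hG : Measurable (fun (p : (ℕ → E) × E) k => if k ≤ n then p.1 k else p.2) := by
        refine measurable_pi_lambda _ fun k => ?_
        split_ifs <;> fun_prop
      rw [stoppedPath_succ, stoppedPath_succ, ← Measure.map_map hG
          ((measurable_stoppedPath h.measurable n).prodMk (h.measurable _)),
        ← Measure.map_map hG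
          ((measurable_stoppedPath h'.measurable n).prodMk (h'.measurable _)),
        h.map_stoppedPath_prodMk, h'.map_stoppedPath_prodMk, ih]
  have := Measure.isProbabilityMeasure_map (μ := Pr) hm.aemeasurable
  refine ext_of_generate_finite _ (generateFrom_measurableCylinders (α := fun _ : ℕ => E)).symm
    isPiSystem_measurableCylinders ?_ ?_
  · intro C hC
    rw [measurableCylinders_nat] at hC
    simp only [mem_iUnion, mem_singleton_iff] at hC
    obtain ⟨n, T, hT, rfl⟩ := hC
    have hCm := MeasurableSet.cylinder (α := fun _ : ℕ => E) (Finset.Iic n) hT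
    have e := DFunLike.congr_fun (key n) (cylinder (Finset.Iic n) T)
    rw [Measure.map_apply (measurable_stoppedPath h.measurable n) hCm,
      Measure.map_apply (measurable_stoppedPath h'.measurable n) hCm] at e
    -- A cylinder over times at most n does not see whether the path was stopped at n.
    have hr : ∀ f : ℕ → E, (Finset.Iic n).restrict f =
        (Finset.Iic n).restrict (fun k => f (min k n)) := by
      intro f
      ext k
      simp [min_eq_left (Finset.mem_Iic.1 k.2)]
    rw [Measure.map_apply hm hCm, Measure.map_apply hm' hCm]
    convert e using 2
    · ext ω
      simp only [mem_preimage, mem_cylinder]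
      rw [hr]
      rfl
    · ext ω
      simp only [mem_preimage, mem_cylinder]
      rw [hr]
      rfl
  · simp [Measure.map_apply hm, Measure.map_apply hm']

/-- The one-dimensional laws of a Markov process are determined by the kernel and the initial
law. -/
theorem map_eq {Ω' : Type*} [MeasurableSpace Ω'] {X' : ℕ → Ω' → E} {Pr' : Measure Ω'}
    [IsProbabilityMeasure Pr] [IsProbabilityMeasure Pr'] [IsMarkovKernel κ]
    (h : IsMarkovProcess κ μ X Pr) (h' : IsMarkovProcess κ μ X' Pr') (n : ℕ) :
    Pr.map (X n) = Pr'.map (X' n) := by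
  have := congrArg (Measure.map fun f : ℕ → E => f n) (h.map_path_eq h')
  rwa [Measure.map_map (measurable_pi_apply n) (measurable_pi_lambda _ h.measurable),
    Measure.map_map (measurable_pi_apply n) (measurable_pi_lambda _ h'.measurable)] at this

end IsMarkovProcess

/-- A Markov process with given kernel and initial law exists on the space of trajectories. -/
theorem exists_isMarkovProcess (κ : Kernel E E) [IsMarkovKernel κ] (μ : Measure E)
    [IsProbabilityMeasure μ] :
    ∃ Pr : Measure (ℕ → E), IsProbabilityMeasure Pr ∧
      IsMarkovProcess κ μ (fun n (ω : ℕ → E) => ω n) Pr := by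
  -- Ionescu-Tulcea with kernels that read only the last coordinate of the history.
  let η : (n : ℕ) → Kernel (Π _ : Finset.Iic n, E) E := fun n =>
    κ.comap (fun f => f ⟨n, Finset.mem_Iic.2 le_rfl⟩) (measurable_pi_apply _)
  have hη : ∀ n, IsMarkovKernel (η n) := fun n => by dsimp only [η]; infer_instance
  let Pr : Measure (ℕ → E) := Kernel.trajMeasure (X := fun _ => E) μ η
  have hPr : IsProbabilityMeasure Pr := by dsimp only [Pr]; infer_instance
  refine ⟨Pr, hPr, fun n => measurable_pi_apply n, ?_, ?_⟩
  · have h0 : Measurable (fun f : (Π _ : Finset.Iic 0, E) => f ⟨0, Finset.mem_Iic.2 le_rfl⟩) :=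
      measurable_pi_apply _
    have e : Pr.map (Preorder.frestrictLe 0) =
        μ.map (MeasurableEquiv.piUnique (fun _ : Finset.Iic 0 => E)).symm := by
      dsimp only [Pr]
      rw [Kernel.trajMeasure, Measure.map_comp _ _ (by fun_prop), Kernel.traj_map_frestrictLe,
        Kernel.partialTraj_self, Measure.id_comp]
    have := congrArg (Measure.map fun f : (Π _ : Finset.Iic 0, E) =>
      f ⟨0, Finset.mem_Iic.2 le_rfl⟩) e
    rw [Measure.map_map h0 (by fun_prop), Measure.map_map h0 (by fun_prop)] at this
    refine Eq.trans this ?_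
    exact Measure.map_id
  · intro n A hA B hB
    have hle : past (fun n (ω : ℕ → E) => ω n) n ≤
        MeasurableSpace.comap (Preorder.frestrictLe (π := fun _ : ℕ => E) n) inferInstance := by
      refine iSup₂_le fun j hj => ?_
      change MeasurableSpace.comap ((fun f : (Π _ : Finset.Iic n, E) =>
        f ⟨j, Finset.mem_Iic.2 hj⟩) ∘ Preorder.frestrictLe (π := fun _ : ℕ => E) n) _ ≤ _
      rw [← MeasurableSpace.comap_comp]
      exact MeasurableSpace.comap_mono (measurable_pi_apply _).comap_le
    obtain ⟨T, hT, rfl⟩ := hle B hB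
    have e := DFunLike.congr_fun
      (Kernel.map_frestrictLe_trajMeasure_compProd_eq_map_trajMeasure
        (X := fun _ => E) (μ₀ := μ) (κ := η) (a := n)) (T ×ˢ A)
    rw [Measure.compProd_apply_prod hT hA, Measure.map_apply (by fun_prop) (hT.prod hA),
      setLIntegral_map hT (Kernel.measurable_coe _ hA) (by fun_prop)] at e
    exact e.symm

end MarkovProcess

/-! ### Selecting the pair from the state; common part and excess -/

section Selection

variable {S : Type*}

/-- The pair of coupled values read off from `(η¹, η², ξ, ζ)`. -/
def coupledPair (y : S × S × S × Fin 2) : S × S :=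
  (if y.2.2.2 = 1 then y.1 else y.2.2.1, if y.2.2.2 = 1 then y.2.1 else y.2.2.1)

variable [MeasurableSpace S]

theorem measurableSet_switch (i : Fin 2) :
    MeasurableSet {y : S × S × S × Fin 2 | y.2.2.2 = i} :=
  (measurable_snd.comp (measurable_snd.comp measurable_snd)) (measurableSet_singleton i)

theorem measurable_coupledPair : Measurable (coupledPair : S × S × S × Fin 2 → S × S) := by
  refine Measurable.prodMk ?_ ?_
  · exact Measurable.ite (measurableSet_switch 1) (by fun_prop) (by fun_prop)
  · exact Measurable.ite (measurableSet_switch 1) (by fun_prop) (by fun_prop)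

theorem measurable_diag : Measurable (fun x : S => (x, x)) := by fun_prop

/-- By independence, the value of the switch decides between an independent pair and a single point
copied to both coordinates; the preimage of a rectangle splits accordingly into two disjoint boxes.
-/
theorem map_coupledPair_prod (α β γ : Measure S) (τ : Measure (Fin 2)) [IsProbabilityMeasure α]
    [IsProbabilityMeasure β] [IsProbabilityMeasure γ] [IsFiniteMeasure τ] :
    (α.prod (β.prod (γ.prod τ))).map coupledPair =
      τ {1} • α.prod β + τ {0} • γ.map (fun x => (x, x)) := by
  refine Measure.ext_prod fun {A B} hA hB => ?_
  have e : coupledPair ⁻¹' (A ×ˢ B) = A ×ˢ (B ×ˢ (univ ×ˢ ({1} : Set (Fin 2)))) ∪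
      univ ×ˢ (univ ×ˢ ((A ∩ B) ×ˢ ({0} : Set (Fin 2)))) := by
    ext ⟨x, y, z, i⟩
    fin_cases i <;> simp [coupledPair]
  rw [Measure.map_apply measurable_coupledPair (hA.prod hB), e, measure_union]
  · simp only [Measure.prod_prod, measure_univ, Measure.add_apply, Measure.smul_apply,
      smul_eq_mul, Measure.map_apply measurable_diag (hA.prod hB), one_mul]
    rw [show (fun x : S => (x, x)) ⁻¹' A ×ˢ B = A ∩ B from rfl]
    ring
  · refine disjoint_left.2 ?_
    rintro ⟨x, y, z, i⟩ h h'
    simp only [mem_prod, mem_singleton_iff] at h h'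
    exact absurd (h.2.2.2.symm.trans h'.2.2.2) (by decide)
  · exact MeasurableSet.univ.prod (MeasurableSet.univ.prod
      ((hA.inter hB).prod (measurableSet_singleton 0)))

theorem switchLaw_zero (a : ℝ≥0∞) : switchLaw a {0} = a := by simp [switchLaw]

theorem switchLaw_one (a : ℝ≥0∞) : switchLaw a {1} = 1 - a := by simp [switchLaw]

theorem excess_self (μ : Measure S) : excess μ μ = 0 := by simp [excess]

theorem commonPart_self (μ : Measure S) [IsFiniteMeasure μ] : commonPart μ μ = μ := by
  simpa [excess_self] using commonPart_add_excess μ μ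

theorem overlap_self (μ : Measure S) [IsProbabilityMeasure μ] : overlap μ μ = 1 := by
  rw [← commonPart_univ, commonPart_self, measure_univ]

theorem commonPart_eq_zero {μ ν : Measure S} (h : overlap μ ν = 0) : commonPart μ ν = 0 := by
  rwa [← Measure.measure_univ_eq_zero, commonPart_univ]

theorem excess_eq_zero {μ ν : Measure S} [IsProbabilityMeasure μ] [IsFiniteMeasure ν]
    (h : overlap μ ν = 1) : excess μ ν = 0 := by
  rw [← Measure.measure_univ_eq_zero, excess_apply, commonPart_univ, h, measure_univ, tsub_self]

/-- Full overlap leaves an excess of mass zero. With the right-hand version, two probability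
measures of overlap 1 coincide. -/
theorem commonPart_eq_left {μ ν : Measure S} [IsProbabilityMeasure μ] [IsFiniteMeasure ν]
    (h : overlap μ ν = 1) : commonPart μ ν = μ := by
  simpa [excess_eq_zero h] using commonPart_add_excess μ ν

theorem commonPart_eq_right {μ ν : Measure S} [IsFiniteMeasure μ] [IsProbabilityMeasure ν]
    (h : overlap μ ν = 1) : commonPart μ ν = ν := by
  rw [commonPart_comm, commonPart_eq_left (overlap_comm μ ν ▸ h)]

theorem overlap_smul_inv_smul_commonPart {μ ν : Measure S} [IsProbabilityMeasure μ]
    [IsFiniteMeasure ν] (h : overlap μ ν ≠ 0) :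
    overlap μ ν • (overlap μ ν)⁻¹ • commonPart μ ν = commonPart μ ν := by
  rw [smul_smul, ENNReal.mul_inv_cancel h
    (ne_top_of_le_ne_top ENNReal.one_ne_top (overlap_le_one μ ν)), one_smul]

theorem one_sub_overlap_smul_inv_smul {μ ν : Measure S} [IsProbabilityMeasure μ]
    [IsFiniteMeasure ν] (h : overlap μ ν ≠ 1) (ρ : Measure S) :
    (1 - overlap μ ν) • (1 - overlap μ ν)⁻¹ • ρ = ρ := by
  rw [smul_smul, ENNReal.mul_inv_cancel
    (tsub_pos_of_lt (lt_of_le_of_ne (overlap_le_one μ ν) h)).ne'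
    (ENNReal.sub_ne_top ENNReal.one_ne_top), one_smul]

theorem excess_add_commonPart (μ ν : Measure S) [IsFiniteMeasure μ] [IsFiniteMeasure ν] :
    excess μ ν + commonPart μ ν = μ := by
  rw [add_comm, commonPart_add_excess]

theorem excess_add_commonPart' (μ ν : Measure S) [IsFiniteMeasure μ] [IsFiniteMeasure ν] :
    excess ν μ + commonPart μ ν = ν := by
  rw [commonPart_comm, excess_add_commonPart]

theorem isProbabilityMeasure_excess_swap {μ ν : Measure S} [IsFiniteMeasure μ]
    [IsProbabilityMeasure ν] (h : overlap μ ν ≠ 1) :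
    IsProbabilityMeasure ((1 - overlap μ ν)⁻¹ • excess ν μ) := by
  rw [overlap_comm] at h ⊢
  exact isProbabilityMeasure_excess h

theorem map_fst_mix (a b : ℝ≥0∞) (α β γ : Measure S) [IsProbabilityMeasure α]
    [IsProbabilityMeasure β] :
    (a • α.prod β + b • γ.map (fun x => (x, x))).map Prod.fst = a • α + b • γ := by
  rw [Measure.map_add _ _ measurable_fst, Measure.map_smul, Measure.map_smul,
    Measure.map_fst_prod, Measure.map_map measurable_fst measurable_diag, measure_univ, one_smul]
  congr 2
  exact Measure.map_id

theorem map_snd_mix (a b : ℝ≥0∞) (α β γ : Measure S) [IsProbabilityMeasure α]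
    [IsProbabilityMeasure β] :
    (a • α.prod β + b • γ.map (fun x => (x, x))).map Prod.snd = a • β + b • γ := by
  rw [Measure.map_add _ _ measurable_snd, Measure.map_smul, Measure.map_smul,
    Measure.map_snd_prod, Measure.map_map measurable_snd measurable_diag, measure_univ, one_smul]
  congr 2
  exact Measure.map_id

end Selection

/-! ### Marginals of the initial law -/

section Initial

variable {S : Type*} [MeasurableSpace S] (μ₁ μ₂ : Measure S) [IsProbabilityMeasure μ₁]
  [IsProbabilityMeasure μ₂]

instance isProbabilityMeasure_couplingInit : IsProbabilityMeasure (couplingInit μ₁ μ₂) := by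
  unfold couplingInit
  split_ifs with h0 h1
  · exact Measure.isProbabilityMeasure_map (by fun_prop)
  · exact Measure.isProbabilityMeasure_map (by fun_prop)
  · have := isProbabilityMeasure_excess h1
    have := isProbabilityMeasure_excess_swap h1
    have := isProbabilityMeasure_commonPart h0
    have := isProbabilityMeasure_switchLaw (overlap_le_one μ₁ μ₂)
    infer_instance

theorem couplingInit_map_coupledPair :
    ((couplingInit μ₁ μ₂).map coupledPair).map Prod.fst = μ₁ ∧
      ((couplingInit μ₁ μ₂).map coupledPair).map Prod.snd = μ₂ := by
  unfold couplingInit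
  split_ifs with h0 h1
  · rw [Measure.map_map measurable_coupledPair (by fun_prop)]
    have : (coupledPair ∘ fun x : S × S => (x.1, x.2, x.1, (1 : Fin 2))) = id := by
      ext x <;> simp [coupledPair]
    simp [this]
  · rw [Measure.map_map measurable_coupledPair (by fun_prop)]
    have : (coupledPair ∘ fun x : S => (x, x, x, (0 : Fin 2))) = fun x => (x, x) := by
      ext x <;> simp [coupledPair]
    rw [this, Measure.map_map measurable_fst measurable_diag,
      Measure.map_map measurable_snd measurable_diag]
    refine ⟨Measure.map_id, Measure.map_id.trans ?_⟩
    -- Overlap 1 makes both initial laws equal to their common part, hence to each other.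
    rw [← commonPart_eq_left h1, commonPart_eq_right h1]
  · have := isProbabilityMeasure_excess h1
    have := isProbabilityMeasure_excess_swap h1
    have := isProbabilityMeasure_commonPart h0
    have := isProbabilityMeasure_switchLaw (overlap_le_one μ₁ μ₂)
    rw [map_coupledPair_prod, map_fst_mix, map_snd_mix, switchLaw_zero, switchLaw_one,
      one_sub_overlap_smul_inv_smul h1, one_sub_overlap_smul_inv_smul h1,
      overlap_smul_inv_smul_commonPart h0]
    exact ⟨excess_add_commonPart _ _, excess_add_commonPart' _ _⟩

end Initial

/-! ### The kernel of the pair and its marginals -/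

section PairKernel

variable {S : Type*} [MeasurableSpace S] {κ : Kernel S S} [IsMarkovKernel κ]

theorem couplingKernel_map_coupledPair (hκ : MeasurableCommonPart κ) (x : S × S × S × Fin 2) :
    (couplingKernel κ hκ x).map coupledPair =
      phi₄ κ x {1} • (phi₁ κ x).prod (phi₂ κ x) +
        phi₄ κ x {0} • (phi₃ κ x).map (fun x => (x, x)) :=
  map_coupledPair_prod _ _ _ _

/-- The weight erases the convention made for zero overlap: there both sides vanish. The two lemmas
below do the same for the excess at overlap 1. -/
theorem overlap_smul_phi₃ {x : S × S × S × Fin 2} (hx : x.2.2.2 = 1) :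
    overlap (κ x.1) (κ x.2.1) • phi₃ κ x = commonPart (κ x.1) (κ x.2.1) := by
  by_cases h : overlap (κ x.1) (κ x.2.1) = 0
  · rw [commonPart_eq_zero h, h, zero_smul]
  · rw [phi₃, if_pos ⟨hx, h⟩, overlap_smul_inv_smul_commonPart h]

theorem one_sub_overlap_smul_phi₁ (x : S × S × S × Fin 2) :
    (1 - overlap (κ x.1) (κ x.2.1)) • phi₁ κ x = excess (κ x.1) (κ x.2.1) := by
  unfold phi₁
  split_ifs with h
  · rw [excess_eq_zero h, h, tsub_self, zero_smul]
  · exact one_sub_overlap_smul_inv_smul h _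

theorem one_sub_overlap_smul_phi₂ (x : S × S × S × Fin 2) :
    (1 - overlap (κ x.1) (κ x.2.1)) • phi₂ κ x = excess (κ x.2.1) (κ x.1) := by
  unfold phi₂
  split_ifs with h
  · rw [excess_eq_zero (overlap_comm (κ x.1) _ ▸ h), h, tsub_self, zero_smul]
  · exact one_sub_overlap_smul_inv_smul h _

theorem couplingKernel_map_coupledPair_of_one (hκ : MeasurableCommonPart κ)
    {x : S × S × S × Fin 2} (hx : x.2.2.2 = 1) :
    (couplingKernel κ hκ x).map coupledPair =
      (1 - overlap (κ x.1) (κ x.2.1)) • (phi₁ κ x).prod (phi₂ κ x) +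
        (commonPart (κ x.1) (κ x.2.1)).map (fun x => (x, x)) := by
  rw [couplingKernel_map_coupledPair, phi₄, if_pos hx, switchLaw_one, switchLaw_zero,
    ← Measure.map_smul, overlap_smul_phi₃ hx]

theorem couplingKernel_map_coupledPair_of_ne_one (hκ : MeasurableCommonPart κ)
    {x : S × S × S × Fin 2} (hx : x.2.2.2 ≠ 1) :
    (couplingKernel κ hκ x).map coupledPair = (κ x.2.2.1).map (fun x => (x, x)) := by
  rw [couplingKernel_map_coupledPair, phi₄, if_neg hx, phi₃, if_neg (fun h => hx h.1)]
  simp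

/-- The transition kernel of the coupled pair. -/
noncomputable def pairKernel (hκ : MeasurableCommonPart κ) : Kernel (S × S) (S × S) :=
  -- Every pair is represented by an uncoupled state. The filler `z.1` in the place of ξ is
  -- immaterial: it enters only when the overlap is 0, and then the switch never selects ξ.
  ((couplingKernel κ hκ).comap (fun z : S × S => (z.1, z.2, z.1, (1 : Fin 2)))
    (by fun_prop)).map coupledPair

theorem pairKernel_apply (hκ : MeasurableCommonPart κ) (z : S × S) :
    pairKernel hκ z = (couplingKernel κ hκ (z.1, z.2, z.1, 1)).map coupledPair := by
  rw [pairKernel, Kernel.map_apply _ measurable_coupledPair, Kernel.comap_apply]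

instance (hκ : MeasurableCommonPart κ) : IsMarkovKernel (pairKernel hκ) :=
  Kernel.IsMarkovKernel.map _ measurable_coupledPair

/-- The selection map lumps the coupling kernel to the kernel of the pair. -/
theorem couplingKernel_map_eq_pairKernel (hκ : MeasurableCommonPart κ)
    (x : S × S × S × Fin 2) :
    (couplingKernel κ hκ x).map coupledPair = pairKernel hκ (coupledPair x) := by
  rw [pairKernel_apply, couplingKernel_map_coupledPair_of_one hκ
    (x := ((coupledPair x).1, (coupledPair x).2, (coupledPair x).1, 1)) rfl]
  by_cases hx : x.2.2.2 = 1
  · rw [couplingKernel_map_coupledPair_of_one hκ hx]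
    simp [coupledPair, hx, phi₁, phi₂]
  · rw [couplingKernel_map_coupledPair_of_ne_one hκ hx]
    -- On the diagonal the overlap is 1, so the uncoupled formula reduces to its diagonal part.
    simp [coupledPair, hx, overlap_self, commonPart_self]

/-- The weight 1 - δ cancels the normalisation of the excess, and adding the common part restores
the full transition probability. -/
theorem pairKernel_map_fst (hκ : MeasurableCommonPart κ) (z : S × S) :
    (pairKernel hκ z).map Prod.fst = κ z.1 := by
  rw [pairKernel_apply, couplingKernel_map_coupledPair_of_one hκ rfl, ← one_smul ℝ≥0∞
    (Measure.map (fun x => (x, x)) _), map_fst_mix, one_sub_overlap_smul_phi₁, one_smul]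
  exact excess_add_commonPart _ _

theorem pairKernel_map_snd (hκ : MeasurableCommonPart κ) (z : S × S) :
    (pairKernel hκ z).map Prod.snd = κ z.2 := by
  rw [pairKernel_apply, couplingKernel_map_coupledPair_of_one hκ rfl, ← one_smul ℝ≥0∞
    (Measure.map (fun x => (x, x)) _), map_snd_mix, one_sub_overlap_smul_phi₂, one_smul]
  exact excess_add_commonPart' _ _

end PairKernel

/-! ### The coupling inequality -/

section TotalVariation

variable {S Ω : Type*} [MeasurableSpace S] [MeasurableSpace Ω]

/-- If U lies in A, then V lies in A or U ≠ V. Only monotonicity and subadditivity are applied to {U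
≠ V}, so it need not be measurable. -/
theorem map_real_sub_le_measure_ne {Pr : Measure Ω} [IsFiniteMeasure Pr] {U V : Ω → S}
    (hU : Measurable U) (hV : Measurable V) {A : Set S} (hA : MeasurableSet A) :
    (Pr.map U).real A - (Pr.map V).real A ≤ Pr.real {ω | U ω ≠ V ω} := by
  rw [map_measureReal_apply hU hA, map_measureReal_apply hV hA, sub_le_iff_le_add']
  refine (measureReal_mono fun ω hω => ?_).trans (measureReal_union_le _ _)
  by_cases h : U ω = V ω
  · exact Or.inl (by simpa [← h] using hω)
  · exact Or.inr h

/-- The coupling inequality. -/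
theorem half_tvNorm_le_measure_ne {μ ν : Measure S} [IsFiniteMeasure μ]
    [IsFiniteMeasure ν] {Pr : Measure Ω} [IsFiniteMeasure Pr] {U V : Ω → S} (hU : Measurable U)
    (hV : Measurable V) (hμ : Pr.map U = μ) (hν : Pr.map V = ν) :
    2⁻¹ * tvNorm μ ν ≤ Pr {ω | U ω ≠ V ω} := by
  subst hμ hν
  set s := (Pr.map U).toSignedMeasure - (Pr.map V).toSignedMeasure with hs
  have hval : ∀ A, MeasurableSet A → s A = (Pr.map U).real A - (Pr.map V).real A :=
    fun A hA => by simp [hs, Measure.toSignedMeasure_apply_measurable hA]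
  -- On a Hahn set `i` the positive part has mass s(i), the negative part mass -s(iᶜ). Each is at
  -- most the probability of U ≠ V, which explains the factor 1/2.
  obtain ⟨i, hi, hi₁, hi₂, hpos, hneg⟩ := s.toJordanDecomposition_spec
  have hp : s.toJordanDecomposition.posPart univ ≤ Pr {ω | U ω ≠ V ω} := by
    rw [← ENNReal.toReal_le_toReal (measure_ne_top _ _) (measure_ne_top _ _), ← measureReal_def,
      ← measureReal_def, hpos,
      SignedMeasure.toMeasureOfZeroLE_real_apply _ _ hi MeasurableSet.univ, inter_univ, hval i hi]
    exact map_real_sub_le_measure_ne hU hV hi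
  have hn : s.toJordanDecomposition.negPart univ ≤ Pr {ω | U ω ≠ V ω} := by
    rw [← ENNReal.toReal_le_toReal (measure_ne_top _ _) (measure_ne_top _ _), ← measureReal_def,
      ← measureReal_def, hneg,
      SignedMeasure.toMeasureOfLEZero_real_apply _ _ hi.compl MeasurableSet.univ, inter_univ,
      hval _ hi.compl, neg_sub]
    simpa only [ne_comm] using map_real_sub_le_measure_ne (Pr := Pr) hV hU hi.compl
  unfold tvNorm SignedMeasure.totalVariation
  rw [Measure.add_apply, ← hs]
  calc _ ≤ 2⁻¹ * (Pr {ω | U ω ≠ V ω} + Pr {ω | U ω ≠ V ω}) := by gcongr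
    _ = _ := by rw [← two_mul, ← mul_assoc, ENNReal.inv_mul_cancel (by simp) (by simp), one_mul]

end TotalVariation

/-! ### One step of the switch and of (η¹, η²) -/

section CouplingKernel

variable {S : Type*} [MeasurableSpace S]

/-- The indicator form makes a one-step integral again an integrand of the kind used in
`lintegral_switch_le`. -/
theorem phi₄_one (κ : Kernel S S) (x : S × S × S × Fin 2) :
    phi₄ κ x {1} = {y : S × S × S × Fin 2 | y.2.2.2 = 1}.indicator
      (fun y => 1 - overlap (κ y.1) (κ y.2.1)) x := by
  by_cases h : x.2.2.2 = 1
  · simp [phi₄, h, switchLaw_one]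
  · simp [phi₄, h]

variable {κ : Kernel S S} [IsMarkovKernel κ]

theorem couplingKernel_switch (hκ : MeasurableCommonPart κ) (x : S × S × S × Fin 2) (i : Fin 2) :
    couplingKernel κ hκ x {y | y.2.2.2 = i} = phi₄ κ x {i} := by
  have : {y : S × S × S × Fin 2 | y.2.2.2 = i} = univ ×ˢ (univ ×ˢ (univ ×ˢ {i})) := by
    ext y; simp
  rw [this]
  change ((phi₁ κ x).prod ((phi₂ κ x).prod ((phi₃ κ x).prod (phi₄ κ x)))) _ = _
  simp [Measure.prod_prod]

/-- Under the transition kernel `ζ` is independent of `(η¹, η²)`. -/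
theorem lintegral_couplingKernel_switch (hκ : MeasurableCommonPart κ) (x : S × S × S × Fin 2)
    {f : S × S → ℝ≥0∞} (hf : Measurable f) :
    ∫⁻ y, {y : S × S × S × Fin 2 | y.2.2.2 = 1}.indicator (fun y => f (y.1, y.2.1)) y
        ∂couplingKernel κ hκ x =
      phi₄ κ x {1} * ∫⁻ y, f (y.1, y.2.1) ∂couplingKernel κ hκ x := by
  have hg : Measurable (fun y : S × S × S × Fin 2 => f (y.1, y.2.1)) := by fun_prop
  rw [lintegral_indicator (measurableSet_switch 1)]
  have hp : Measurable (fun y : S × S × S × Fin 2 => (y.1, y.2.1)) := by fun_prop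
  rw [← lintegral_map (f := f) hf hp, ← lintegral_map (f := f) hf hp, ← smul_eq_mul,
    ← lintegral_smul_measure]
  -- It remains to see that the law of (η¹, η²) on {ζ = 1} is a multiple of its full law; on
  -- rectangles the product measure factors.
  congr 1
  have : IsFiniteMeasure (((couplingKernel κ hκ x).restrict {y | y.2.2.2 = 1}).map
    (fun y => (y.1, y.2.1))) := inferInstance
  refine Measure.ext_prod fun {A B} hA hB => ?_
  rw [Measure.smul_apply, Measure.map_apply hp (hA.prod hB), Measure.map_apply hp (hA.prod hB),
    Measure.restrict_apply (hp (hA.prod hB))]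
  have e1 : (fun y : S × S × S × Fin 2 => (y.1, y.2.1)) ⁻¹' A ×ˢ B ∩ {y | y.2.2.2 = 1} =
      A ×ˢ (B ×ˢ (univ ×ˢ {1})) := by
    ext y; simp [and_assoc]
  have e2 : (fun y : S × S × S × Fin 2 => (y.1, y.2.1)) ⁻¹' A ×ˢ B =
      A ×ˢ (B ×ˢ (univ ×ˢ univ)) := by
    ext y; simp
  rw [e1, e2]
  change ((phi₁ κ x).prod ((phi₂ κ x).prod ((phi₃ κ x).prod (phi₄ κ x)))) _ =
    phi₄ κ x {1} * ((phi₁ κ x).prod ((phi₂ κ x).prod ((phi₃ κ x).prod (phi₄ κ x)))) _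
  simp only [Measure.prod_prod, measure_univ]
  ring

/-- The transition of `(η¹, η²)` depends on `(η¹, η²)` only. -/
theorem lintegral_couplingKernel_congr (hκ : MeasurableCommonPart κ) (x : S × S × S × Fin 2)
    {f : S × S → ℝ≥0∞} (hf : Measurable f) :
    ∫⁻ y, f (y.1, y.2.1) ∂couplingKernel κ hκ x =
      ∫⁻ y, f (y.1, y.2.1) ∂couplingKernel κ hκ (x.1, x.2.1, x.1, 1) := by
  have hp : Measurable (fun y : S × S × S × Fin 2 => (y.1, y.2.1)) := by fun_prop
  have e : ∀ x, (couplingKernel κ hκ x).map (fun y => (y.1, y.2.1)) =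
      (phi₁ κ x).prod (phi₂ κ x) := by
    intro x
    refine Measure.ext_prod fun {A B} hA hB => ?_
    rw [Measure.map_apply hp (hA.prod hB)]
    have e2 : (fun y : S × S × S × Fin 2 => (y.1, y.2.1)) ⁻¹' A ×ˢ B =
        A ×ˢ (B ×ˢ (univ ×ˢ univ)) := by
      ext y; simp
    rw [e2]
    change ((phi₁ κ x).prod ((phi₂ κ x).prod ((phi₃ κ x).prod (phi₄ κ x)))) _ = _
    simp only [Measure.prod_prod, measure_univ, mul_one]
  rw [← lintegral_map (f := f) hf hp, ← lintegral_map (f := f) hf hp, e, e]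
  rfl

end CouplingKernel

/-! ### Absorption of the switch and the coupling estimate -/

section CoupledChain

variable {S Ω : Type*} [MeasurableSpace S] [MeasurableSpace Ω] {κ : Kernel S S} [IsMarkovKernel κ]
  {hκ : MeasurableCommonPart κ} {μ : Measure (S × S × S × Fin 2)}
  {Pr : Measure Ω} {Y : ℕ → Ω → S × S × S × Fin 2}

/-- From ζ = 0 the next switch law is the point mass at 0, so the Markov property gives probability
zero to a jump from 0 to 1. -/
theorem ae_switch_eq_zero_succ (hY : IsMarkovProcess (couplingKernel κ hκ) μ Y Pr) (n : ℕ) :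
    ∀ᵐ ω ∂Pr, (Y n ω).2.2.2 = 0 → (Y (n + 1) ω).2.2.2 = 0 := by
  have hB : MeasurableSet[past Y n] (Y n ⁻¹' {y | y.2.2.2 = 0}) :=
    comap_le_past Y le_rfl _ ⟨_, measurableSet_switch 0, rfl⟩
  have h := hY.markov n _ (measurableSet_switch 1) _ hB
  have h0 : ∫⁻ ω in Y n ⁻¹' {y | y.2.2.2 = 0}, couplingKernel κ hκ (Y n ω) {y | y.2.2.2 = 1} ∂Pr
      = 0 := by
    rw [setLIntegral_congr_fun (g := fun _ => 0) (hY.measurable n (measurableSet_switch 0)) ?_]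
    · simp
    · intro ω hω
      have hω' : (Y n ω).2.2.2 = 0 := hω
      simp only [couplingKernel_switch]
      simp [phi₄, hω']
  rw [h0] at h
  refine (measure_eq_zero_iff_ae_notMem.1 h).mono fun ω hω h1 => ?_
  by_contra h2
  refine hω ⟨h1, ?_⟩
  change (Y (n + 1) ω).2.2.2 = 1
  omega

/-- From the coupling time on the coupled values coincide. -/
theorem ae_coupled_eq (hY : IsMarkovProcess (couplingKernel κ hκ) μ Y Pr) :
    ∀ᵐ ω ∂Pr, ∀ n : ℕ, couplingTime Y ω ≤ n → coupled₁ Y n ω = coupled₂ Y n ω := by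
  filter_upwards [ae_all_iff.2 (ae_switch_eq_zero_succ hY)] with ω hω n hn
  -- If no zero of ζ occurred by time n, the infimum would be at least n + 1; this also covers an
  -- infinite coupling time.
  obtain ⟨⟨k, hk⟩, hkn⟩ : ∃ k : {k : ℕ // (Y k ω).2.2.2 = 0}, ((k : ℕ) : ℕ∞) ≤ n := by
    by_contra! hcon
    have : ((n + 1 : ℕ) : ℕ∞) ≤ couplingTime Y ω :=
      le_iInf fun k => by exact_mod_cast Order.add_one_le_of_lt (Nat.cast_lt.1 (hcon k))
    exact absurd (this.trans hn) (by exact_mod_cast Nat.not_succ_le_self n)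
  have h0 : (Y n ω).2.2.2 = 0 :=
    Nat.le_induction hk (fun j _ hj => hω j hj) n (by exact_mod_cast hkn)
  simp [coupled₁, coupled₂, h0]

/-- The arbitrary test function f makes the induction close: a step turns f into (1 - δ) times its
one-step average. -/
theorem lintegral_switch_le [IsFiniteMeasure Pr]
    (hY : IsMarkovProcess (couplingKernel κ hκ) μ Y Pr) (n : ℕ) :
    ∀ f : S × S → ℝ≥0∞, Measurable f →
      ∫⁻ ω, {y : S × S × S × Fin 2 | y.2.2.2 = 1}.indicator (fun y => f (y.1, y.2.1)) (Y n ω) ∂Pr ≤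
        ∫⁻ ω, (∏ i ∈ Finset.range n, (1 - overlap (κ (Y i ω).1) (κ (Y i ω).2.1))) *
          f ((Y n ω).1, (Y n ω).2.1) ∂Pr := by
  have hδ : Measurable (fun z : S × S => 1 - overlap (κ z.1) (κ z.2)) :=
    measurable_const.sub (measurable_overlap hκ)
  have hδ' : Measurable (fun y : S × S × S × Fin 2 => 1 - overlap (κ y.1) (κ y.2.1)) :=
    measurable_const.sub (measurable_overlap' hκ)
  induction n with
  | zero =>
    intro f hf
    -- The only loss in the estimate: the initial indicator of ζ = 1 is bounded by 1.
    refine lintegral_mono fun ω => ?_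
    simpa using indicator_le_self _ (fun y : S × S × S × Fin 2 => f (y.1, y.2.1)) (Y 0 ω)
  | succ n ih =>
    intro f hf
    have hg : Measurable (fun y : S × S × S × Fin 2 => f (y.1, y.2.1)) := by fun_prop
    -- The transition operator of (η¹, η²) applied to f; the values put for ξ and ζ are immaterial.
    let T : S × S → ℝ≥0∞ := fun z =>
      ∫⁻ y, f (y.1, y.2.1) ∂couplingKernel κ hκ (z.1, z.2, z.1, 1)
    have hT : Measurable T :=
      (hg.lintegral_kernel (κ := couplingKernel κ hκ)).comp (by fun_prop)
    have hTx : ∀ x, ∫⁻ y, f (y.1, y.2.1) ∂couplingKernel κ hκ x = T (x.1, x.2.1) :=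
      fun x => lintegral_couplingKernel_congr hκ x hf
    have h1 := hY.lintegral_stoppedPath n (f := fun p =>
      {y : S × S × S × Fin 2 | y.2.2.2 = 1}.indicator (fun y => f (y.1, y.2.1)) p.2)
      ((hg.indicator (measurableSet_switch 1)).comp measurable_snd)
    have hD : Measurable (fun p : (ℕ → S × S × S × Fin 2) × (S × S × S × Fin 2) =>
        ∏ i ∈ Finset.range (n + 1), (1 - overlap (κ (p.1 i).1) (κ (p.1 i).2.1))) :=
      Finset.measurable_prod _ fun i _ =>
        hδ'.comp ((measurable_pi_apply i).comp measurable_fst)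
    have h2 := hY.lintegral_stoppedPath n (f := fun p =>
      (∏ i ∈ Finset.range (n + 1), (1 - overlap (κ (p.1 i).1) (κ (p.1 i).2.1))) *
        f (p.2.1, p.2.2.1)) (hD.mul (hg.comp measurable_snd))
    -- The factors have indices at most n, so stopping at n does not change them.
    have hs : ∀ ω, (∏ i ∈ Finset.range (n + 1), (1 - overlap (κ (stoppedPath Y n ω i).1)
        (κ (stoppedPath Y n ω i).2.1))) =
        ∏ i ∈ Finset.range (n + 1), (1 - overlap (κ (Y i ω).1) (κ (Y i ω).2.1)) := fun ω =>
      Finset.prod_congr rfl fun i hi => by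
        rw [stoppedPath, min_eq_left (Nat.lt_succ_iff.1 (Finset.mem_range.1 hi))]
    simp only [hs] at h2
    rw [h1, h2]
    -- The factor 1 - δ is the chance of keeping ζ = 1 in the last step; it becomes the factor of
    -- index n in the product.
    have h3 := ih (fun z => (1 - overlap (κ z.1) (κ z.2)) * T z) (hδ.mul hT)
    convert h3 using 3 with ω ω
    · rw [lintegral_couplingKernel_switch hκ _ hf, hTx, phi₄_one]
      by_cases h : (Y n ω).2.2.2 = 1 <;> simp [h]
    · rw [lintegral_const_mul _ hg, hTx, Finset.prod_range_succ, mul_assoc]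

/-- The coupling estimate in terms of `(η¹, η²)`. -/
theorem measure_coupled_ne_le [IsFiniteMeasure Pr]
    (hY : IsMarkovProcess (couplingKernel κ hκ) μ Y Pr) (n : ℕ) :
    Pr {ω | coupled₁ Y n ω ≠ coupled₂ Y n ω} ≤
      ∫⁻ ω, ∏ i ∈ Finset.range n, (1 - overlap (κ (Y i ω).1) (κ (Y i ω).2.1)) ∂Pr := by
  have h := lintegral_switch_le hY n (fun _ => 1) measurable_const
  simp only [mul_one] at h
  refine le_trans ?_ h
  have e : ∀ ω, {y : S × S × S × Fin 2 | y.2.2.2 = 1}.indicator (fun _ => (1 : ℝ≥0∞)) (Y n ω) =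
      (Y n ⁻¹' {y | y.2.2.2 = 1}).indicator 1 ω := fun ω => rfl
  simp only [e]
  rw [lintegral_indicator_one (hY.measurable n (measurableSet_switch 1))]
  -- If ζ ≠ 1, both components equal ξ.
  refine measure_mono fun ω hω => ?_
  by_contra hcon
  have : ¬ (Y n ω).2.2.2 = 1 := hcon
  exact hω (by simp [coupled₁, coupled₂, this])

end CoupledChain

end MarkovCoupling

/-! ### The main theorem -/

theorem mainTheorem8 {S : Type u} [MeasurableSpace S]
    (P : Kernel S S) [IsMarkovKernel P] (m : ℕ) (hm : 1 ≤ m)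
    (hP : MarkovCoupling.MeasurableCommonPart (P ^ m)) :
    -- one transition kernel `Q` of the pair serves for all initial distributions
    ∃ Q : Kernel (S × S) (S × S), IsMarkovKernel Q ∧
      ∀ (μ₁ μ₂ : Measure S) [IsProbabilityMeasure μ₁] [IsProbabilityMeasure μ₂],
        -- the process `(η¹, η², ξ, ζ)` exists
        (∃ (Ω : Type u) (_ : MeasurableSpace Ω) (Pr : Measure Ω) (_ : IsProbabilityMeasure Pr)
          (Y : ℕ → Ω → S × S × S × Fin 2),
          MarkovCoupling.IsMarkovProcess (MarkovCoupling.couplingKernel (P ^ m) hP)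
            (MarkovCoupling.couplingInit μ₁ μ₂) Y Pr) ∧
        -- and every realisation `Y` of it (`Y n` is the value at time `n * m`), compared with any
        -- versions `X₁`, `X₂` of the chain with initial distributions `μ₁`, `μ₂`, satisfies:
        ∀ {Ω₁ : Type v₁} {Ω₂ : Type v₂} {Ω : Type v}
          [MeasurableSpace Ω₁] [MeasurableSpace Ω₂] [MeasurableSpace Ω]
          (Pr₁ : Measure Ω₁) (Pr₂ : Measure Ω₂) (Pr : Measure Ω)
          [IsProbabilityMeasure Pr₁] [IsProbabilityMeasure Pr₂] [IsProbabilityMeasure Pr]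
          (X₁ : ℕ → Ω₁ → S) (X₂ : ℕ → Ω₂ → S) (Y : ℕ → Ω → S × S × S × Fin 2),
          MarkovCoupling.IsMarkovProcess P μ₁ X₁ Pr₁ →
          MarkovCoupling.IsMarkovProcess P μ₂ X₂ Pr₂ →
          MarkovCoupling.IsMarkovProcess (MarkovCoupling.couplingKernel (P ^ m) hP)
            (MarkovCoupling.couplingInit μ₁ μ₂) Y Pr →
          -- equality of the one-dimensional laws
          (∀ n : ℕ,
            Pr.map (MarkovCoupling.coupled₁ Y n) = Pr₁.map (X₁ (n * m)) ∧
            Pr.map (MarkovCoupling.coupled₂ Y n) = Pr₂.map (X₂ (n * m))) ∧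
          -- equality of the laws in the space of trajectories
          Pr.map (fun ω n => MarkovCoupling.coupled₁ Y n ω) =
            Pr₁.map (fun ω (n : ℕ) => X₁ (n * m) ω) ∧
          Pr.map (fun ω n => MarkovCoupling.coupled₂ Y n ω) =
            Pr₂.map (fun ω (n : ℕ) => X₂ (n * m) ω) ∧
          -- each component is a Markov process with the `m`-step transition kernel
          MarkovCoupling.IsMarkovProcess (P ^ m) μ₁ (MarkovCoupling.coupled₁ Y) Pr ∧
          MarkovCoupling.IsMarkovProcess (P ^ m) μ₂ (MarkovCoupling.coupled₂ Y) Pr ∧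
          -- the pair is a homogeneous Markov process
          MarkovCoupling.IsMarkovProcess Q
            (Pr.map fun ω => (MarkovCoupling.coupled₁ Y 0 ω, MarkovCoupling.coupled₂ Y 0 ω))
            (fun n ω => (MarkovCoupling.coupled₁ Y n ω, MarkovCoupling.coupled₂ Y n ω)) Pr ∧
          -- the components coincide from the coupling time on
          (∀ᵐ ω ∂Pr, ∀ n : ℕ, MarkovCoupling.couplingTime Y ω ≤ n →
            MarkovCoupling.coupled₁ Y n ω = MarkovCoupling.coupled₂ Y n ω) ∧
          -- the coupling estimate
          ∀ n : ℕ,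
            2⁻¹ * MarkovCoupling.tvNorm (Pr₁.map (X₁ (n * m))) (Pr₂.map (X₂ (n * m))) ≤
              Pr {ω | MarkovCoupling.coupled₁ Y n ω ≠ MarkovCoupling.coupled₂ Y n ω} ∧
            Pr {ω | MarkovCoupling.coupled₁ Y n ω ≠ MarkovCoupling.coupled₂ Y n ω} ≤
              ∫⁻ ω, ∏ i ∈ Finset.range n,
                (1 - MarkovCoupling.overlap ((P ^ m) (Y i ω).1) ((P ^ m) (Y i ω).2.1)) ∂Pr := by
  -- This kernel is built from `P ^ m` alone, hence serves all initial laws.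
  refine ⟨MarkovCoupling.pairKernel hP, inferInstance, fun μ₁ μ₂ _ _ => ⟨?_, ?_⟩⟩
  · obtain ⟨Pr, hPr, hY⟩ := MarkovCoupling.exists_isMarkovProcess
      (MarkovCoupling.couplingKernel (P ^ m) hP) (MarkovCoupling.couplingInit μ₁ μ₂)
    exact ⟨_, _, Pr, hPr, _, hY⟩
  intro Ω₁ Ω₂ Ω _ _ _ Pr₁ Pr₂ Pr _ _ _ X₁ X₂ Y hX₁ hX₂ hY
  have hpair := hY.lump MarkovCoupling.measurable_coupledPair
    (MarkovCoupling.couplingKernel_map_eq_pairKernel hP)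
  have h₁ : MarkovCoupling.IsMarkovProcess (P ^ m) μ₁ (MarkovCoupling.coupled₁ Y) Pr := by
    -- A second lumping, from the pair to one coordinate.
    have := hpair.lump measurable_fst (MarkovCoupling.pairKernel_map_fst hP)
    rwa [(MarkovCoupling.couplingInit_map_coupledPair μ₁ μ₂).1] at this
  have h₂ : MarkovCoupling.IsMarkovProcess (P ^ m) μ₂ (MarkovCoupling.coupled₂ Y) Pr := by
    have := hpair.lump measurable_snd (MarkovCoupling.pairKernel_map_snd hP)
    rwa [(MarkovCoupling.couplingInit_map_coupledPair μ₁ μ₂).2] at this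
  have e₁ := h₁.map_path_eq (hX₁.skeleton m)
  have e₂ := h₂.map_path_eq (hX₂.skeleton m)
  have l₁ := fun n => h₁.map_eq (hX₁.skeleton m) n
  have l₂ := fun n => h₂.map_eq (hX₂.skeleton m) n
  refine ⟨fun n => ⟨l₁ n, l₂ n⟩, e₁, e₂, h₁, h₂, ?_, MarkovCoupling.ae_coupled_eq hY, fun n =>
    ⟨MarkovCoupling.half_tvNorm_le_measure_ne (h₁.measurable n) (h₂.measurable n) (l₁ n) (l₂ n),
      MarkovCoupling.measure_coupled_ne_le hY n⟩⟩
  have hinit := hpair.init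
  rw [← hinit] at hpair
  exact hpair
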